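/- **Theorem.** Let $\kappa\in(0,1)$ and $\lambda=\sqrt{1-\kappa^2}$. Let $f(T)=\int_0^T {}_2F_1(\tfrac14,\tfrac34;\tfrac12;\kappa^2\sin^2 t)\,dt$ for complex $T$ near $0$, let $\phi$ be the analytic local inverse of $f$ near $0$ with $\phi(0)=0$, and let $\psi$ be the analytic function near $0$ with $\psi(0)=0$ and $\sin\psi=\kappa\sin\phi$. Then $\cos\psi$ extends uniquely to a meromorphic function $d_\kappa$ on $\mathbb{C}$. This function is elliptic, and it has fundamental periods $2K_\kappa$ and $2iK'_\kappa$ (that is, an $\mathbb{R}$-linearly independent pair whose integral combinations are exactly the periods of $d_\kappa$) for exactly one pair of real numbers $K_\kappa>0$, $K'_\kappa>0$, namely $$K_\kappa=\sqrt{\frac{2}{1+\lambda}}\;K\Big(\frac{1-\lambda}{1+\lambda}\Big)\qquad\text{and}\qquad K'_\kappa=\sqrt{\frac{2}{1+\lambda}}\;K\Big(\frac{2\lambda}{1+\lambda}\Big),$$ where $K(k^2)=\int_0^{\pi/2}\frac{d\theta}{\sqrt{1-k^2\sin^2\theta}}$ for $0<k<1$ is the complete elliptic integral of the first kind, taken as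 a function of $k^2$. -/

import Mathlib

open Filter Topology

noncomputable section

namespace SignatureFour

/-- The function `f(T) = ∫₀ᵀ F(1/4, 3/4; 1/2; κ² sin² t) dt` of a complex variable `T`, the integral
being taken along the segment `t = s T`, `0 ≤ s ≤ 1`. Only its germ at `0` is used. -/
def incompleteIntegral (κ : ℝ) (T : ℂ) : ℂ :=
  T * ∫ s in (0 : ℝ)..1,
    ordinaryHypergeometric (1 / 4 : ℂ) (3 / 4 : ℂ) (1 / 2 : ℂ)
      ((κ : ℂ) ^ 2 * Complex.sin ((s : ℂ) * T) ^ 2)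

/-- `φ` is (the germ at `0` of) the analytic local inverse of `f` with `φ 0 = 0`. -/
structure IsLocalAmplitude (κ : ℝ) (φ : ℂ → ℂ) : Prop where
  analyticAt : AnalyticAt ℂ φ 0
  map_zero : φ 0 = 0
  right_inv : ∀ᶠ u in 𝓝 (0 : ℂ), incompleteIntegral κ (φ u) = u
  left_inv : ∀ᶠ t in 𝓝 (0 : ℂ), φ (incompleteIntegral κ t) = t

/-- `ψ` is (the germ at `0` of) the analytic function with `ψ 0 = 0` and `sin ψ = κ sin φ`. -/
structure IsAuxiliaryAngle (κ : ℝ) (φ ψ : ℂ → ℂ) : Prop where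
  analyticAt : AnalyticAt ℂ ψ 0
  map_zero : ψ 0 = 0
  sin_eq : ∀ᶠ u in 𝓝 (0 : ℂ), Complex.sin (ψ u) = (κ : ℂ) * Complex.sin (φ u)

/-- `d` is the function `dn₂` of modulus `κ`: the meromorphic function on the whole plane that is
given near `0` by `d = cos ψ`. Normal form means that `d` takes the value `0` at each of its poles
and its limiting value at every other point, so `d` is determined as a function `ℂ → ℂ`.
Double periodicity is not part of the definition. -/
structure IsDn (κ : ℝ) (d : ℂ → ℂ) : Prop where
  meromorphic : MeromorphicNFOn d Set.univ
  eq_cos : ∃ φ ψ : ℂ → ℂ, IsLocalAmplitude κ φ ∧ IsAuxiliaryAngle κ φ ψ ∧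
    ∀ᶠ u in 𝓝 (0 : ℂ), d u = Complex.cos (ψ u)

/-- `w₁` and `w₂` are fundamental periods of `d`: they are linearly independent over `ℝ`, and the
periods of `d` are exactly the integral combinations of `w₁` and `w₂`. -/
def IsFundamentalPeriods (d : ℂ → ℂ) (w₁ w₂ : ℂ) : Prop :=
  LinearIndependent ℝ ![w₁, w₂] ∧
    ∀ w : ℂ, Function.Periodic d w ↔ ∃ m n : ℤ, w = (m : ℂ) * w₁ + (n : ℂ) * w₂

/-- The complete elliptic integral of the first kind as a function of the parameter `m = k²`. -/
def ellipticK (m : ℝ) : ℝ :=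
  ∫ θ in (0 : ℝ)..(Real.pi / 2), 1 / √(1 - m * Real.sin θ ^ 2)

end SignatureFour

end

namespace SignatureFour

/-! ### The hypergeometric function of signature four -/

/-! The even part of `(1 - w) ^ (-1/2)` is `F(1/4, 3/4; 1/2; w²)`. At `w = sin p` the roots can be
extracted, so `F(sin² p) = cos (p/2) / cos p` (`hypergeometric_sin_sq`). Since `κ sin φ = sin ψ`,
inverting `f` gives `φ' = cos ψ / cos (ψ/2)`. Hence `σ = sin (ψ/2)` has `σ' = (κ/2) cos φ` and
solves `σ'' = -σ + 2σ³` with `σ(0) = 0`, `σ'(0) = κ/2` (`hasDerivAt_sin_half_angle`).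

The solution is `σ = b sn(a u)` with `a² = (1 + λ)/2`, `b² = (1 - λ)/2` and parameter `m = (1 -
λ)/(1 + λ)`, so `cos ψ = 1 - 2σ² = 1 - (1 - λ) sn²(a u)`. ODE uniqueness on the real line and the
identity theorem give this near `0` (`cos_eq_dnTwo`).

The global `sn` is assembled from real Jacobi functions of parameters `m` and `1 - m` through the
formula for `sn(x + iy)`; the Cauchy–Riemann equations show it is holomorphic off its poles. Its
square has periods `2K(m)` and `2iK(1 - m)`. There are no others: a period of `1 - 2c sn²` carries
`0` to a point of value `1`, that is, to a zero of `sn`, and those zeros form this lattice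
(`eq_lattice_of_snForm_eq_one`). Rescaling by `1/a` gives the stated periods, and a rectangular
lattice determines its positive half-periods. -/

lemma ascPochhammer_eval_succ_complex (a : ℂ) (n : ℕ) :
    (ascPochhammer ℂ (n + 1)).eval a = (ascPochhammer ℂ n).eval a * (a + n) := by
  simp [ascPochhammer_succ_right]

/-- Consecutive factors pair up: `(1/2 + 2n)(1/2 + 2n + 1) = 4 (1/4 + n)(3/4 + n)`. -/
lemma ascPochhammer_half_double (n : ℕ) :
    (ascPochhammer ℂ (2 * n)).eval (1 / 2) =
      4 ^ n * (ascPochhammer ℂ n).eval (1 / 4) * (ascPochhammer ℂ n).eval (3 / 4) := by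
  induction n with
  | zero => simp
  | succ n ih =>
    rw [show 2 * (n + 1) = 2 * n + 1 + 1 by ring]
    simp only [ascPochhammer_eval_succ_complex]
    rw [ih]
    push_cast
    ring

lemma factorial_double (n : ℕ) :
    ((2 * n).factorial : ℂ) = 4 ^ n * n.factorial * (ascPochhammer ℂ n).eval (1 / 2) := by
  induction n with
  | zero => simp
  | succ n ih =>
    rw [show 2 * (n + 1) = 2 * n + 1 + 1 by ring]
    simp only [ascPochhammer_eval_succ_complex, Nat.factorial_succ]
    push_cast
    rw [ih]
    ring

lemma ascPochhammer_half_ne_zero (n : ℕ) : (ascPochhammer ℂ n).eval (1 / 2) ≠ 0 := by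
  intro h
  have := factorial_double n
  rw [h, mul_zero] at this
  exact Nat.factorial_ne_zero _ (by exact_mod_cast this)

/-- Quotient of the two duplication formulas above; it identifies the even Taylor coefficients of
`(1 - w) ^ (-1/2)`. -/
lemma choose_half_double (n : ℕ) :
    Ring.choose ((1 / 2 : ℂ) + (2 * n : ℕ) - 1) (2 * n) =
      ordinaryHypergeometricCoefficient (1 / 4 : ℂ) (3 / 4) (1 / 2) n := by
  have h := Ring.descPochhammer_eq_factorial_smul_choose ((1 / 2 : ℂ) + (2 * n : ℕ) - 1) (2 * n)
  rw [Polynomial.descPochhammer_smeval_eq_ascPochhammer, Polynomial.ascPochhammer_smeval_cast,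
    Polynomial.ascPochhammer_smeval_eq_eval, nsmul_eq_mul,
    show (1 / 2 : ℂ) + (2 * n : ℕ) - 1 - (2 * n : ℕ) + 1 = 1 / 2 by ring,
    ascPochhammer_half_double, factorial_double] at h
  have h1 := ascPochhammer_half_ne_zero n
  have h2 : (n.factorial : ℂ) ≠ 0 := by exact_mod_cast Nat.factorial_ne_zero n
  have h3 : (4 : ℂ) ^ n ≠ 0 := pow_ne_zero _ (by norm_num)
  have h4 : (ascPochhammer ℂ n).eval (1 / 4) * (ascPochhammer ℂ n).eval (3 / 4) =
      n.factorial * (ascPochhammer ℂ n).eval (1 / 2) *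
        Ring.choose ((1 / 2 : ℂ) + (2 * n : ℕ) - 1) (2 * n) := by
    apply mul_left_cancel₀ h3
    linear_combination h
  generalize Ring.choose ((1 / 2 : ℂ) + (2 * n : ℕ) - 1) (2 * n) = r at h4 ⊢
  rw [ordinaryHypergeometricCoefficient, mul_assoc _ (Polynomial.eval (1 / 4) _), h4]
  field_simp

lemma hasSum_one_div_one_sub_sqrt {w : ℂ} (hw : ‖w‖ < 1) :
    HasSum (fun n : ℕ ↦ Ring.choose ((1 / 2 : ℂ) + n - 1) n * w ^ n)
      (1 / (1 - w) ^ (1 / 2 : ℂ)) := by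
  have h := (Complex.one_div_one_sub_cpow_hasFPowerSeriesOnBall_zero (1 / 2)).hasSum
    (y := w) (by
      rw [← ENNReal.ofReal_one, Metric.eball_ofReal]
      simpa using hw)
  simpa [FormalMultilinearSeries.ofScalars_apply_eq, mul_comm] using h

/-- Averaging the binomial series at `w` and `-w` cancels the odd terms. -/
lemma hypergeometric_sq {w : ℂ} (hw : ‖w‖ < 1) :
    ordinaryHypergeometric (1 / 4 : ℂ) (3 / 4 : ℂ) (1 / 2 : ℂ) (w ^ 2) =
      (1 / (1 - w) ^ (1 / 2 : ℂ) + 1 / (1 + w) ^ (1 / 2 : ℂ)) / 2 := by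
  have h1 := hasSum_one_div_one_sub_sqrt hw
  have h2 := hasSum_one_div_one_sub_sqrt (w := -w) (by simpa using hw)
  have h3 := (h1.add h2).div_const 2
  have hinj : Function.Injective (fun n : ℕ ↦ 2 * n) := fun a b h ↦ by simpa using h
  rw [← hinj.hasSum_iff] at h3
  · rw [ordinaryHypergeometric, ordinaryHypergeometric_sum_eq]
    rw [sub_neg_eq_add] at h3
    rw [← h3.tsum_eq]
    refine tsum_congr fun n ↦ ?_
    have := choose_half_double n
    simp only [Function.comp_apply]
    rw [this, (even_two_mul n).neg_pow, pow_mul, smul_eq_mul]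
    ring
  · intro n hn
    have hodd : Odd n := by
      rw [← Nat.not_even_iff_odd]
      rintro ⟨k, rfl⟩
      exact hn ⟨k, by simp; ring⟩
    simp [hodd.neg_pow]

/-- `1 ∓ sin p = (cos (p/2) ∓ sin (p/2))²`, and near `0` these bases have positive real part, so the
principal square root returns them. -/
lemma hypergeometric_sin_sq :
    ∀ᶠ p in 𝓝 (0 : ℂ), ordinaryHypergeometric (1 / 4 : ℂ) (3 / 4 : ℂ) (1 / 2 : ℂ)
      (Complex.sin p ^ 2) = Complex.cos (p / 2) / Complex.cos p := by
  have e1 : ∀ᶠ p in 𝓝 (0 : ℂ), ‖Complex.sin p‖ < 1 :=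
    (by fun_prop : ContinuousAt (fun p : ℂ ↦ ‖Complex.sin p‖) 0).eventually_lt_const (by simp)
  have e2 : ∀ᶠ p in 𝓝 (0 : ℂ), 0 < (Complex.cos (p / 2) - Complex.sin (p / 2)).re :=
    (by fun_prop : ContinuousAt (fun p : ℂ ↦
      (Complex.cos (p / 2) - Complex.sin (p / 2)).re) 0).eventually_const_lt (by simp)
  have e3 : ∀ᶠ p in 𝓝 (0 : ℂ), 0 < (Complex.cos (p / 2) + Complex.sin (p / 2)).re :=
    (by fun_prop : ContinuousAt (fun p : ℂ ↦
      (Complex.cos (p / 2) + Complex.sin (p / 2)).re) 0).eventually_const_lt (by simp)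
  filter_upwards [e1, e2, e3] with p h1 h2 h3
  have hs : Complex.sin p = 2 * Complex.sin (p / 2) * Complex.cos (p / 2) := by
    rw [← Complex.sin_two_mul]; congr 1; ring
  have hc : Complex.cos p = Complex.cos (p / 2) ^ 2 - Complex.sin (p / 2) ^ 2 := by
    rw [← Complex.cos_two_mul']; congr 1; ring
  have hp := Complex.sin_sq_add_cos_sq (p / 2)
  rw [hypergeometric_sq h1,
    show 1 - Complex.sin p = (Complex.cos (p / 2) - Complex.sin (p / 2)) ^ 2 by
      rw [hs]; linear_combination -hp,
    show 1 + Complex.sin p = (Complex.cos (p / 2) + Complex.sin (p / 2)) ^ 2 by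
      rw [hs]; linear_combination -hp,
    show (1 / 2 : ℂ) = 2⁻¹ by norm_num,
    Complex.sq_cpow_two_inv h2, Complex.sq_cpow_two_inv h3, hc]
  have n2 : Complex.cos (p / 2) - Complex.sin (p / 2) ≠ 0 := by
    intro h; rw [h] at h2; simp at h2
  have n3 : Complex.cos (p / 2) + Complex.sin (p / 2) ≠ 0 := by
    intro h; rw [h] at h3; simp at h3
  rw [show Complex.cos (p / 2) ^ 2 - Complex.sin (p / 2) ^ 2 =
    (Complex.cos (p / 2) - Complex.sin (p / 2)) * (Complex.cos (p / 2) + Complex.sin (p / 2)) by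
      ring]
  field_simp
  ring

lemma analyticAt_hypergeometric :
    AnalyticAt ℂ (ordinaryHypergeometric (1 / 4 : ℂ) (3 / 4 : ℂ) (1 / 2 : ℂ) : ℂ → ℂ) 0 := by
  have hr : (ordinaryHypergeometricSeries ℂ (1 / 4 : ℂ) (3 / 4) (1 / 2)).radius = 1 := by
    apply ordinaryHypergeometricSeries_radius_eq_one
    intro n
    -- No parameter is a nonpositive integer, so the series does not terminate or degenerate.
    refine ⟨fun h ↦ ?_, fun h ↦ ?_, fun h ↦ ?_⟩ <;>
    · have := congrArg Complex.re h
      norm_num at this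
      have h0 : (0 : ℝ) ≤ n := n.cast_nonneg
      linarith
  exact ((ordinaryHypergeometricSeries ℂ (1 / 4 : ℂ) (3 / 4) (1 / 2)).hasFPowerSeriesOnBall
    (by rw [hr]; exact one_pos)).analyticAt

/-! ### The incomplete integral and its local inverse -/

/-- On a disc `G` has a primitive vanishing at `0`, which the segment integral must equal; no
differentiation under the integral sign is needed. -/
lemma hasDerivAt_mul_segment_integral {G : ℂ → ℂ} (hG : AnalyticAt ℂ G 0) :
    ∀ᶠ T in 𝓝 (0 : ℂ), HasDerivAt (fun T : ℂ ↦ T * ∫ s in (0 : ℝ)..1, G ((s : ℂ) * T)) (G T) T := by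
  obtain ⟨r, hr, hd⟩ : ∃ r > 0, ∀ z ∈ Metric.ball (0 : ℂ) r, DifferentiableAt ℂ G z := by
    have := (Complex.analyticAt_iff_eventually_differentiableAt.mp hG)
    exact Metric.eventually_nhds_iff_ball.mp this
  have hdo : DifferentiableOn ℂ G (Metric.ball 0 r) :=
    fun z hz ↦ (hd z hz).differentiableWithinAt
  obtain ⟨P, hP0, hP⟩ := hdo.isExactOn_ball.with_val_at 0 0
  have key : ∀ T ∈ Metric.ball (0 : ℂ) r, T * ∫ s in (0 : ℝ)..1, G ((s : ℂ) * T) = P T := by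
    intro T hT
    have hm : ∀ s ∈ Set.uIcc (0 : ℝ) 1, (s : ℂ) * T ∈ Metric.ball (0 : ℂ) r := by
      intro s hs
      rw [Set.uIcc_of_le zero_le_one] at hs
      rw [mem_ball_zero_iff] at hT ⊢
      rw [norm_mul, Complex.norm_real, Real.norm_of_nonneg hs.1]
      exact (mul_le_of_le_one_left (norm_nonneg _) hs.2).trans_lt hT
    rw [← intervalIntegral.integral_const_mul]
    rw [intervalIntegral.integral_eq_sub_of_hasDerivAt (f := fun s : ℝ ↦ P ((s : ℂ) * T))]
    · simp [hP0]
    · intro s hs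
      have h1 : HasDerivAt (fun s : ℝ ↦ (s : ℂ) * T) T s := by
        simpa using (Complex.ofRealCLM.hasDerivAt (x := s)).mul_const T
      have := (hP _ (hm s hs)).comp s h1
      simpa [mul_comm, Function.comp_def] using this
    · apply ContinuousOn.intervalIntegrable
      apply ContinuousOn.mul continuousOn_const
      exact hdo.continuousOn.comp (by fun_prop) hm
  filter_upwards [Metric.ball_mem_nhds (0 : ℂ) hr] with T hT
  refine (hP T hT).congr_of_eventuallyEq ?_
  filter_upwards [Metric.isOpen_ball.mem_nhds hT] with S hS using key S hS

lemma hasDerivAt_incompleteIntegral (κ : ℝ) :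
    ∀ᶠ T in 𝓝 (0 : ℂ), HasDerivAt (incompleteIntegral κ)
      (ordinaryHypergeometric (1 / 4 : ℂ) (3 / 4 : ℂ) (1 / 2 : ℂ)
        ((κ : ℂ) ^ 2 * Complex.sin T ^ 2)) T := by
  have hG : AnalyticAt ℂ (fun T : ℂ ↦ ordinaryHypergeometric (1 / 4 : ℂ) (3 / 4 : ℂ) (1 / 2 : ℂ)
        ((κ : ℂ) ^ 2 * Complex.sin T ^ 2)) 0 := by
    apply AnalyticAt.fun_comp (g := ordinaryHypergeometric (1 / 4 : ℂ) (3 / 4 : ℂ) (1 / 2 : ℂ))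
    · simpa using analyticAt_hypergeometric
    · fun_prop
  exact hasDerivAt_mul_segment_integral hG

lemma analyticAt_incompleteIntegral (κ : ℝ) : AnalyticAt ℂ (incompleteIntegral κ) 0 :=
  Complex.analyticAt_iff_eventually_differentiableAt.mpr
    ((hasDerivAt_incompleteIntegral κ).mono fun _ h ↦ h.differentiableAt)

lemma incompleteIntegral_zero (κ : ℝ) : incompleteIntegral κ 0 = 0 := by
  simp [incompleteIntegral]

lemma deriv_incompleteIntegral_zero (κ : ℝ) : deriv (incompleteIntegral κ) 0 = 1 := by
  rw [(hasDerivAt_incompleteIntegral κ).self_of_nhds.deriv]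
  simp [ordinaryHypergeometric_zero]

/-- An analytic function that fixes `0` with nonzero derivative has an analytic local inverse. -/
lemma exists_analytic_local_inverse {f : ℂ → ℂ} (hf : AnalyticAt ℂ f 0) (h0 : f 0 = 0)
    (h1 : deriv f 0 ≠ 0) :
    ∃ g : ℂ → ℂ, AnalyticAt ℂ g 0 ∧ g 0 = 0 ∧ (∀ᶠ u in 𝓝 (0 : ℂ), f (g u) = u) ∧
      ∀ᶠ t in 𝓝 (0 : ℂ), g (f t) = t := by
  have hs : HasStrictDerivAt f (deriv f 0) 0 := hf.hasStrictDerivAt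
  have hl := hs.eventually_left_inverse h1
  have ha := hf.analyticAt_localInverse h1
  have hr := hs.eventually_right_inverse h1
  rw [h0] at ha hr
  refine ⟨hs.localInverse f (deriv f 0) 0 h1, ha, ?_, hr, hl⟩
  simpa [h0] using hl.self_of_nhds

lemma exists_isLocalAmplitude (κ : ℝ) : ∃ φ, IsLocalAmplitude κ φ := by
  obtain ⟨g, h1, h2, h3, h4⟩ := exists_analytic_local_inverse (analyticAt_incompleteIntegral κ)
    (incompleteIntegral_zero κ) (by simp [deriv_incompleteIntegral_zero])
  exact ⟨g, h1, h2, h3, h4⟩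

lemma exists_isAuxiliaryAngle {κ : ℝ} {φ : ℂ → ℂ} (hφ : IsLocalAmplitude κ φ) :
    ∃ ψ, IsAuxiliaryAngle κ φ ψ := by
  obtain ⟨g, h1, h2, h3, -⟩ := exists_analytic_local_inverse (f := Complex.sin) (by fun_prop)
    (by simp) (by simp)
  have ha : AnalyticAt ℂ (fun u ↦ (κ : ℂ) * Complex.sin (φ u)) 0 := by
    have := hφ.analyticAt
    fun_prop
  have hz : (κ : ℂ) * Complex.sin (φ 0) = 0 := by simp [hφ.map_zero]
  refine ⟨fun u ↦ g (κ * Complex.sin (φ u)), AnalyticAt.fun_comp (by rwa [hz]) ha, by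
    simp [hφ.map_zero, h2], ?_⟩
  have ht : Tendsto (fun u ↦ (κ : ℂ) * Complex.sin (φ u)) (𝓝 0) (𝓝 0) := by
    simpa [hφ.map_zero] using ha.continuousAt.tendsto
  exact ht.eventually h3

/-- Differentiating `f ∘ φ = id` and `sin ψ = κ sin φ` eliminates `φ'` and `ψ'`. The second-order
equation for `sin (ψ/2)` is kept as a first-order system, the form used for ODE uniqueness. -/
lemma hasDerivAt_sin_half_angle {κ : ℝ} {φ ψ : ℂ → ℂ} (hφ : IsLocalAmplitude κ φ)
    (hψ : IsAuxiliaryAngle κ φ ψ) :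
    ∀ᶠ u in 𝓝 (0 : ℂ),
      HasDerivAt (fun u ↦ Complex.sin (ψ u / 2)) (κ / 2 * Complex.cos (φ u)) u ∧
      HasDerivAt (fun u ↦ κ / 2 * Complex.cos (φ u))
        (-Complex.sin (ψ u / 2) + 2 * Complex.sin (ψ u / 2) ^ 3) u := by
  have tφ : Tendsto φ (𝓝 0) (𝓝 0) := by
    simpa [hφ.map_zero] using hφ.analyticAt.continuousAt.tendsto
  have tψ : Tendsto ψ (𝓝 0) (𝓝 0) := by
    simpa [hψ.map_zero] using hψ.analyticAt.continuousAt.tendsto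
  have c1 : ∀ᶠ p in 𝓝 (0 : ℂ), Complex.cos (p / 2) ≠ 0 :=
    (by fun_prop : ContinuousAt (fun p : ℂ ↦ Complex.cos (p / 2)) 0).eventually_ne (by simp)
  have c2 : ∀ᶠ p in 𝓝 (0 : ℂ), Complex.cos p ≠ 0 :=
    (by fun_prop : ContinuousAt (fun p : ℂ ↦ Complex.cos p) 0).eventually_ne (by simp)
  filter_upwards [tφ.eventually (hasDerivAt_incompleteIntegral κ),
    hφ.right_inv.eventually_nhds, hψ.sin_eq.eventually_nhds, tψ.eventually hypergeometric_sin_sq,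
    tψ.eventually c1, tψ.eventually c2,
    Complex.analyticAt_iff_eventually_differentiableAt.mp hφ.analyticAt,
    Complex.analyticAt_iff_eventually_differentiableAt.mp hψ.analyticAt]
    with u hf hr hs hF n1 n2 dφ dψ
  have hs0 := hs.self_of_nhds
  -- `κ² sin² φ = sin² ψ`, so the integrand takes its closed form.
  rw [← mul_pow, ← hs0, hF] at hf
  have e1 : Complex.cos (ψ u / 2) / Complex.cos (ψ u) * deriv φ u = 1 :=
    ((hf.comp u dφ.hasDerivAt).congr_of_eventuallyEq
      (hr.mono fun v hv ↦ by simpa using hv.symm)).unique (hasDerivAt_id u)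
  have e2 : Complex.cos (ψ u) * deriv ψ u = κ * (Complex.cos (φ u) * deriv φ u) :=
    (dψ.hasDerivAt.csin.congr_of_eventuallyEq (hs.mono fun v hv ↦ by simpa using hv.symm)).unique
      (dφ.hasDerivAt.csin.const_mul (κ : ℂ))
  have e3 : Complex.cos (ψ u / 2) * deriv φ u = Complex.cos (ψ u) := by
    field_simp at e1
    exact e1
  have e4 : Complex.cos (ψ u / 2) * deriv ψ u = κ * Complex.cos (φ u) := by
    apply mul_left_cancel₀ n2
    linear_combination Complex.cos (ψ u / 2) * e2 + κ * Complex.cos (φ u) * e3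
  have d1 : Complex.sin (ψ u) = 2 * Complex.sin (ψ u / 2) * Complex.cos (ψ u / 2) := by
    rw [← Complex.sin_two_mul]; congr 1; ring
  have d2 : Complex.cos (ψ u) = 1 - 2 * Complex.sin (ψ u / 2) ^ 2 := by
    rw [← Complex.cos_two_mul_eq_one_sub]; congr 1; ring
  constructor
  · refine (dψ.hasDerivAt.div_const 2).csin.congr_deriv ?_
    linear_combination e4 / 2
  · refine (dφ.hasDerivAt.ccos.const_mul ((κ : ℂ) / 2)).congr_deriv ?_
    apply mul_left_cancel₀ n1
    rw [d1] at hs0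
    linear_combination (-(κ : ℂ) / 2 * Complex.sin (φ u)) * e3 + Complex.cos (ψ u) * hs0 / 2 -
      Complex.sin (ψ u / 2) * Complex.cos (ψ u / 2) * d2

end SignatureFour

noncomputable section

namespace SignatureFour

/-! ### Real Jacobi elliptic functions -/

lemma one_sub_mul_sin_sq_pos {m : ℝ} (hm : m < 1) (θ : ℝ) : 0 < 1 - m * Real.sin θ ^ 2 := by
  have h1 := Real.sin_sq_le_one θ
  have h2 := sq_nonneg (Real.sin θ)
  rcases le_total 0 m with h | h <;> nlinarith

/-- The incomplete elliptic integral of the first kind with parameter `m`. -/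
def ellipticF (m θ : ℝ) : ℝ := ∫ t in (0 : ℝ)..θ, 1 / √(1 - m * Real.sin t ^ 2)

lemma continuous_ellipticF_integrand {m : ℝ} (hm : m < 1) :
    Continuous fun t ↦ 1 / √(1 - m * Real.sin t ^ 2) :=
  Continuous.div (by fun_prop) (by fun_prop)
    fun t ↦ (Real.sqrt_pos.mpr (one_sub_mul_sin_sq_pos hm t)).ne'

lemma hasDerivAt_ellipticF {m : ℝ} (hm : m < 1) (θ : ℝ) :
    HasDerivAt (ellipticF m) (1 / √(1 - m * Real.sin θ ^ 2)) θ :=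
  ((continuous_ellipticF_integrand hm).integral_hasStrictDerivAt 0 θ).hasDerivAt

lemma ellipticF_zero (m : ℝ) : ellipticF m 0 = 0 := by simp [ellipticF]

lemma ellipticF_pi_div_two (m : ℝ) : ellipticF m (Real.pi / 2) = ellipticK m := rfl

lemma strictMono_ellipticF {m : ℝ} (hm : m < 1) : StrictMono (ellipticF m) :=
  strictMono_of_deriv_pos fun θ ↦ by
    rw [(hasDerivAt_ellipticF hm θ).deriv]
    exact one_div_pos.mpr (Real.sqrt_pos.mpr (one_sub_mul_sin_sq_pos hm θ))

lemma ellipticK_pos {m : ℝ} (hm : m < 1) : 0 < ellipticK m := by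
  rw [← ellipticF_pi_div_two, ← ellipticF_zero m]
  exact strictMono_ellipticF hm (by positivity)

/-- For `m ≥ 0` the integrand is at least `1`; the resulting linear growth makes `ellipticF m` onto.
-/
lemma monotone_ellipticF_sub_id {m : ℝ} (hm₀ : 0 ≤ m) (hm : m < 1) :
    Monotone fun θ ↦ ellipticF m θ - θ := by
  have hd : ∀ θ, HasDerivAt (fun θ ↦ ellipticF m θ - θ) (1 / √(1 - m * Real.sin θ ^ 2) - 1) θ :=
    fun θ ↦ (hasDerivAt_ellipticF hm θ).sub (hasDerivAt_id θ)
  refine monotone_of_deriv_nonneg (fun θ ↦ (hd θ).differentiableAt) fun θ ↦ ?_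
  rw [(hd θ).deriv, sub_nonneg, le_div_iff₀ (Real.sqrt_pos.mpr (one_sub_mul_sin_sq_pos hm θ)),
    one_mul]
  refine Real.sqrt_le_one.mpr ?_
  have := mul_nonneg hm₀ (sq_nonneg (Real.sin θ))
  linarith

lemma continuous_ellipticF {m : ℝ} (hm : m < 1) : Continuous (ellipticF m) :=
  continuous_iff_continuousAt.mpr fun θ ↦ (hasDerivAt_ellipticF hm θ).continuousAt

lemma surjective_ellipticF {m : ℝ} (hm₀ : 0 ≤ m) (hm : m < 1) :
    Function.Surjective (ellipticF m) := by
  have h := monotone_ellipticF_sub_id hm₀ hm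
  refine (continuous_ellipticF hm).surjective ?_ ?_
  · refine tendsto_atTop_mono' _ ?_ tendsto_id
    filter_upwards [eventually_ge_atTop 0] with θ hθ
    have := h hθ
    simp only [ellipticF_zero] at this
    simpa using this
  · refine tendsto_atBot_mono' _ ?_ tendsto_id
    filter_upwards [eventually_le_atBot 0] with θ hθ
    have := h hθ
    simp only [ellipticF_zero] at this
    simpa using this

lemma ellipticF_pi {m : ℝ} (hm : m < 1) : ellipticF m Real.pi = 2 * ellipticK m := by
  have hi : ∀ a b, IntervalIntegrable (fun t ↦ 1 / √(1 - m * Real.sin t ^ 2))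
      MeasureTheory.volume a b := fun a b ↦ (continuous_ellipticF_integrand hm).intervalIntegrable _ _
  have h := intervalIntegral.integral_comp_sub_left
    (fun t ↦ 1 / √(1 - m * Real.sin t ^ 2)) Real.pi (a := 0) (b := Real.pi / 2)
  simp only [Real.sin_pi_sub, sub_zero, show Real.pi - Real.pi / 2 = Real.pi / 2 by ring] at h
  rw [ellipticF, ← intervalIntegral.integral_add_adjacent_intervals (hi 0 (Real.pi / 2)) (hi _ _),
    ← h, ellipticK, two_mul]

lemma ellipticF_add_pi {m : ℝ} (hm : m < 1) (θ : ℝ) :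
    ellipticF m (θ + Real.pi) = ellipticF m θ + 2 * ellipticK m := by
  have hi : ∀ a b, IntervalIntegrable (fun t ↦ 1 / √(1 - m * Real.sin t ^ 2))
      MeasureTheory.volume a b := fun a b ↦ (continuous_ellipticF_integrand hm).intervalIntegrable _ _
  have hp : Function.Periodic (fun t ↦ 1 / √(1 - m * Real.sin t ^ 2)) Real.pi := fun t ↦ by
    simp
  have h := hp.intervalIntegral_add_eq θ 0
  rw [zero_add] at h
  rw [← ellipticF_pi hm, ellipticF, ellipticF, ellipticF, ← h,
    intervalIntegral.integral_add_adjacent_intervals (hi _ _) (hi _ _)]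

/-- The Jacobi amplitude with parameter `m`, the inverse of `ellipticF m`. -/
def jacobiAm (m : ℝ) : ℝ → ℝ := Function.invFun (ellipticF m)

lemma ellipticF_jacobiAm {m : ℝ} (hm₀ : 0 ≤ m) (hm : m < 1) (x : ℝ) :
    ellipticF m (jacobiAm m x) = x :=
  Function.rightInverse_invFun (surjective_ellipticF hm₀ hm) x

lemma jacobiAm_ellipticF {m : ℝ} (hm : m < 1) (θ : ℝ) : jacobiAm m (ellipticF m θ) = θ :=
  Function.leftInverse_invFun (strictMono_ellipticF hm).injective θ

lemma continuous_jacobiAm {m : ℝ} (hm₀ : 0 ≤ m) (hm : m < 1) : Continuous (jacobiAm m) := by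
  refine Monotone.continuous_of_surjective (fun x y hxy ↦ ?_)
    (fun θ ↦ ⟨_, jacobiAm_ellipticF hm θ⟩)
  rwa [← (strictMono_ellipticF hm).le_iff_le, ellipticF_jacobiAm hm₀ hm, ellipticF_jacobiAm hm₀ hm]

lemma jacobiAm_zero {m : ℝ} (hm : m < 1) : jacobiAm m 0 = 0 := by
  have := jacobiAm_ellipticF hm 0
  rwa [ellipticF_zero] at this

lemma jacobiAm_add_two_mul_ellipticK {m : ℝ} (hm₀ : 0 ≤ m) (hm : m < 1) (x : ℝ) :
    jacobiAm m (x + 2 * ellipticK m) = jacobiAm m x + Real.pi := by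
  apply (strictMono_ellipticF hm).injective
  rw [ellipticF_add_pi hm, ellipticF_jacobiAm hm₀ hm, ellipticF_jacobiAm hm₀ hm]

/-- The Jacobi elliptic function `sn` of a real variable with parameter `m`. -/
def jacobiSn (m x : ℝ) : ℝ := Real.sin (jacobiAm m x)

/-- The Jacobi elliptic function `cn` of a real variable with parameter `m`. -/
def jacobiCn (m x : ℝ) : ℝ := Real.cos (jacobiAm m x)

/-- The Jacobi elliptic function `dn` of a real variable with parameter `m`. -/
def jacobiDn (m x : ℝ) : ℝ := √(1 - m * jacobiSn m x ^ 2)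

lemma jacobiCn_sq (m x : ℝ) : jacobiCn m x ^ 2 = 1 - jacobiSn m x ^ 2 := Real.cos_sq' _

lemma jacobiDn_sq {m : ℝ} (hm : m < 1) (x : ℝ) : jacobiDn m x ^ 2 = 1 - m * jacobiSn m x ^ 2 :=
  Real.sq_sqrt (one_sub_mul_sin_sq_pos hm _).le

lemma jacobiDn_pos {m : ℝ} (hm : m < 1) (x : ℝ) : 0 < jacobiDn m x :=
  Real.sqrt_pos.mpr (one_sub_mul_sin_sq_pos hm _)

lemma jacobiSn_zero {m : ℝ} (hm : m < 1) : jacobiSn m 0 = 0 := by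
  simp [jacobiSn, jacobiAm_zero hm]

lemma jacobiCn_zero {m : ℝ} (hm : m < 1) : jacobiCn m 0 = 1 := by
  simp [jacobiCn, jacobiAm_zero hm]

lemma jacobiDn_zero {m : ℝ} (hm : m < 1) : jacobiDn m 0 = 1 := by
  simp [jacobiDn, jacobiSn_zero hm]

lemma hasDerivAt_jacobiAm {m : ℝ} (hm₀ : 0 ≤ m) (hm : m < 1) (x : ℝ) :
    HasDerivAt (jacobiAm m) (jacobiDn m x) x := by
  have hp := Real.sqrt_pos.mpr (one_sub_mul_sin_sq_pos hm (jacobiAm m x))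
  have := HasDerivAt.of_local_left_inverse (continuous_jacobiAm hm₀ hm).continuousAt
    (hasDerivAt_ellipticF hm (jacobiAm m x)) (one_div_pos.mpr hp).ne'
    (Eventually.of_forall fun y ↦ ellipticF_jacobiAm hm₀ hm y)
  simpa [jacobiDn, jacobiSn] using this

lemma hasDerivAt_jacobiSn {m : ℝ} (hm₀ : 0 ≤ m) (hm : m < 1) (x : ℝ) :
    HasDerivAt (jacobiSn m) (jacobiCn m x * jacobiDn m x) x :=
  (hasDerivAt_jacobiAm hm₀ hm x).sin

lemma hasDerivAt_jacobiCn {m : ℝ} (hm₀ : 0 ≤ m) (hm : m < 1) (x : ℝ) :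
    HasDerivAt (jacobiCn m) (-jacobiSn m x * jacobiDn m x) x :=
  (hasDerivAt_jacobiAm hm₀ hm x).cos

lemma hasDerivAt_jacobiDn {m : ℝ} (hm₀ : 0 ≤ m) (hm : m < 1) (x : ℝ) :
    HasDerivAt (jacobiDn m) (-m * jacobiSn m x * jacobiCn m x) x := by
  have hp := jacobiDn_pos hm x
  refine (((((hasDerivAt_jacobiSn hm₀ hm x).pow 2).const_mul m).const_sub 1).sqrt
    (one_sub_mul_sin_sq_pos hm _).ne').congr_deriv ?_
  change _ / (2 * jacobiDn m x) = _
  field_simp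
  push_cast
  ring

lemma jacobiSn_add_two_mul_ellipticK {m : ℝ} (hm₀ : 0 ≤ m) (hm : m < 1) (x : ℝ) :
    jacobiSn m (x + 2 * ellipticK m) = -jacobiSn m x := by
  simp [jacobiSn, jacobiAm_add_two_mul_ellipticK hm₀ hm, Real.sin_add_pi]

lemma jacobiCn_add_two_mul_ellipticK {m : ℝ} (hm₀ : 0 ≤ m) (hm : m < 1) (x : ℝ) :
    jacobiCn m (x + 2 * ellipticK m) = -jacobiCn m x := by
  simp [jacobiCn, jacobiAm_add_two_mul_ellipticK hm₀ hm, Real.cos_add_pi]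

lemma jacobiDn_add_two_mul_ellipticK {m : ℝ} (hm₀ : 0 ≤ m) (hm : m < 1) (x : ℝ) :
    jacobiDn m (x + 2 * ellipticK m) = jacobiDn m x := by
  simp [jacobiDn, jacobiSn_add_two_mul_ellipticK hm₀ hm]

lemma ellipticF_int_mul_pi {m : ℝ} (hm : m < 1) (n : ℤ) :
    ellipticF m (n * Real.pi) = n * (2 * ellipticK m) := by
  -- Subtracting the mean linear growth leaves a `π`-periodic function.
  have hp : Function.Periodic (fun θ ↦ ellipticF m θ - 2 * ellipticK m / Real.pi * θ) Real.pi := by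
    intro θ
    simp only [ellipticF_add_pi hm]
    field_simp
    ring
  have h := hp.int_mul n 0
  simp only [zero_add, ellipticF_zero] at h
  have hpi : 2 * ellipticK m / Real.pi * (n * Real.pi) = n * (2 * ellipticK m) := by
    field_simp
  linarith

lemma eq_int_mul_of_jacobiSn_eq_zero {m : ℝ} (hm₀ : 0 ≤ m) (hm : m < 1) {x : ℝ}
    (h : jacobiSn m x = 0) : ∃ n : ℤ, x = n * (2 * ellipticK m) := by
  obtain ⟨n, hn⟩ := Real.sin_eq_zero_iff.mp h
  exact ⟨n, by rw [← ellipticF_int_mul_pi hm, hn, ellipticF_jacobiAm hm₀ hm]⟩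

end SignatureFour

end

noncomputable section

namespace SignatureFour

/-! ### The Jacobi function `sn` of a complex variable -/

/-- Joint real differentiability is assumed separately, since partial derivatives alone would not
give it. -/
lemma differentiableAt_of_cauchyRiemann {U V : ℝ → ℝ → ℝ} {z : ℂ} {a b : ℝ}
    (hU : DifferentiableAt ℝ (fun w : ℂ ↦ U w.re w.im) z)
    (hV : DifferentiableAt ℝ (fun w : ℂ ↦ V w.re w.im) z)
    (hUx : HasDerivAt (fun x ↦ U x z.im) a z.re) (hVx : HasDerivAt (fun x ↦ V x z.im) b z.re)
    (hUy : HasDerivAt (fun y ↦ U z.re y) (-b) z.im) (hVy : HasDerivAt (fun y ↦ V z.re y) a z.im) :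
    DifferentiableAt ℂ (fun w : ℂ ↦ (U w.re w.im : ℂ) + V w.re w.im * Complex.I) z := by
  have hf : DifferentiableAt ℝ (fun w : ℂ ↦ (U w.re w.im : ℂ) + V w.re w.im * Complex.I) z :=
    (Complex.ofRealCLM.differentiableAt.comp z hU).add
      ((Complex.ofRealCLM.differentiableAt.comp z hV).mul_const Complex.I)
  refine differentiableAt_complex_iff_differentiableAt_real.mpr ⟨hf, ?_⟩
  rw [← hf.lineDeriv_eq_fderiv, ← hf.lineDeriv_eq_fderiv]
  have h1 : HasLineDerivAt ℝ (fun w : ℂ ↦ (U w.re w.im : ℂ) + V w.re w.im * Complex.I)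
      ((a : ℂ) + b * Complex.I) z 1 := by
    have e1 := (HasDerivAt.comp_const_add z.re 0 (by simpa using hUx)).ofReal_comp
    have e2 := (HasDerivAt.comp_const_add z.re 0 (by simpa using hVx)).ofReal_comp
    simpa [HasLineDerivAt] using! e1.add (e2.mul_const Complex.I)
  have h2 : HasLineDerivAt ℝ (fun w : ℂ ↦ (U w.re w.im : ℂ) + V w.re w.im * Complex.I)
      (((-b : ℝ) : ℂ) + a * Complex.I) z Complex.I := by
    have e1 := (HasDerivAt.comp_const_add z.im 0 (by simpa using hUy)).ofReal_comp
    have e2 := (HasDerivAt.comp_const_add z.im 0 (by simpa using hVy)).ofReal_comp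
    simpa [HasLineDerivAt] using! e1.add (e2.mul_const Complex.I)
  rw [h1.lineDeriv, h2.lineDeriv, smul_eq_mul]
  push_cast
  linear_combination (-(b : ℂ)) * Complex.I_sq

/-- The denominator `cn² + m sn² sn²` in the addition theorem for `sn (x + i y)`. -/
def snDen (m x y : ℝ) : ℝ :=
  jacobiCn (1 - m) y ^ 2 + m * jacobiSn m x ^ 2 * jacobiSn (1 - m) y ^ 2

/-- The real part of `sn (x + i y)`. -/
def snRe (m x y : ℝ) : ℝ := jacobiSn m x * jacobiDn (1 - m) y / snDen m x y

/-- The imaginary part of `sn (x + i y)`. -/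
def snIm (m x y : ℝ) : ℝ :=
  jacobiCn m x * jacobiDn m x * (jacobiSn (1 - m) y * jacobiCn (1 - m) y) / snDen m x y

/-- The Jacobi elliptic function `sn` of a complex variable with parameter `m`, with the value `0`
at its poles. -/
def complexSn (m : ℝ) (z : ℂ) : ℂ := (snRe m z.re z.im : ℂ) + snIm m z.re z.im * Complex.I

lemma differentiableAt_snDen {m : ℝ} (hm₀ : 0 < m) (hm : m < 1) (z : ℂ) :
    DifferentiableAt ℝ (fun w : ℂ ↦ snDen m w.re w.im) z := by
  have h1 := (hasDerivAt_jacobiSn hm₀.le hm z.re).differentiableAt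
  have h2 := (hasDerivAt_jacobiSn (m := 1 - m) (by linarith) (by linarith) z.im).differentiableAt
  have h3 := (hasDerivAt_jacobiCn (m := 1 - m) (by linarith) (by linarith) z.im).differentiableAt
  have g1 : DifferentiableAt ℝ (fun w : ℂ ↦ jacobiSn m w.re) z :=
    h1.comp z Complex.reCLM.differentiableAt
  have g2 : DifferentiableAt ℝ (fun w : ℂ ↦ jacobiSn (1 - m) w.im) z :=
    h2.comp z Complex.imCLM.differentiableAt
  have g3 : DifferentiableAt ℝ (fun w : ℂ ↦ jacobiCn (1 - m) w.im) z :=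
    h3.comp z Complex.imCLM.differentiableAt
  exact (g3.pow 2).add (((g1.pow 2).const_mul m).mul (g2.pow 2))

lemma continuous_snDen {m : ℝ} (hm₀ : 0 < m) (hm : m < 1) :
    Continuous (fun w : ℂ ↦ snDen m w.re w.im) :=
  continuous_iff_continuousAt.mpr fun z ↦ (differentiableAt_snDen hm₀ hm z).continuousAt

lemma differentiableAt_complexSn {m : ℝ} (hm₀ : 0 < m) (hm : m < 1) {z : ℂ}
    (hz : snDen m z.re z.im ≠ 0) : DifferentiableAt ℂ (complexSn m) z := by
  have hm' : 0 ≤ 1 - m := by linarith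
  have hm'' : 1 - m < 1 := by linarith
  have s := hasDerivAt_jacobiSn hm₀.le hm z.re
  have c := hasDerivAt_jacobiCn hm₀.le hm z.re
  have d := hasDerivAt_jacobiDn hm₀.le hm z.re
  have s' := hasDerivAt_jacobiSn hm' hm'' z.im
  have c' := hasDerivAt_jacobiCn hm' hm'' z.im
  have d' := hasDerivAt_jacobiDn hm' hm'' z.im
  have ec := jacobiCn_sq m z.re
  have ed := jacobiDn_sq hm z.re
  have ec' := jacobiCn_sq (1 - m) z.im
  have ed' := jacobiDn_sq hm'' z.im
  have gD := differentiableAt_snDen hm₀ hm z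
  have gs : DifferentiableAt ℝ (fun w : ℂ ↦ jacobiSn m w.re) z :=
    s.differentiableAt.comp z Complex.reCLM.differentiableAt
  have gc : DifferentiableAt ℝ (fun w : ℂ ↦ jacobiCn m w.re) z :=
    c.differentiableAt.comp z Complex.reCLM.differentiableAt
  have gd : DifferentiableAt ℝ (fun w : ℂ ↦ jacobiDn m w.re) z :=
    d.differentiableAt.comp z Complex.reCLM.differentiableAt
  have gs' : DifferentiableAt ℝ (fun w : ℂ ↦ jacobiSn (1 - m) w.im) z :=
    s'.differentiableAt.comp z Complex.imCLM.differentiableAt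
  have gc' : DifferentiableAt ℝ (fun w : ℂ ↦ jacobiCn (1 - m) w.im) z :=
    c'.differentiableAt.comp z Complex.imCLM.differentiableAt
  have gd' : DifferentiableAt ℝ (fun w : ℂ ↦ jacobiDn (1 - m) w.im) z :=
    d'.differentiableAt.comp z Complex.imCLM.differentiableAt
  have Dx : HasDerivAt (fun x ↦ snDen m x z.im) _ z.re :=
    (((s.pow 2).const_mul m).mul_const (jacobiSn (1 - m) z.im ^ 2)).const_add
      (jacobiCn (1 - m) z.im ^ 2)
  have Dy : HasDerivAt (fun y ↦ snDen m z.re y) _ z.im :=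
    (c'.pow 2).add ((s'.pow 2).const_mul (m * jacobiSn m z.re ^ 2))
  have hD : snDen m z.re z.im = jacobiCn (1 - m) z.im ^ 2 +
    m * jacobiSn m z.re ^ 2 * jacobiSn (1 - m) z.im ^ 2 := rfl
  have gU : DifferentiableAt ℝ (fun w : ℂ ↦ jacobiSn m w.re * jacobiDn (1 - m) w.im /
      snDen m w.re w.im) z := by
    simpa only [div_eq_mul_inv] using! (gs.mul gd').mul (gD.inv hz)
  have gV : DifferentiableAt ℝ (fun w : ℂ ↦ jacobiCn m w.re * jacobiDn m w.re *
      (jacobiSn (1 - m) w.im * jacobiCn (1 - m) w.im) / snDen m w.re w.im) z := by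
    simpa only [div_eq_mul_inv] using! ((gc.mul gd).mul (gs'.mul gc')).mul (gD.inv hz)
  refine differentiableAt_of_cauchyRiemann (U := snRe m) (V := snIm m) gU gV
    -- `a` and `b` are the `x`-derivatives of the real and imaginary parts; the quadratic relations
    -- among `sn`, `cn`, `dn` match them with the `y`-derivatives.
    (a := jacobiCn m z.re * jacobiDn m z.re * jacobiDn (1 - m) z.im *
      (jacobiCn (1 - m) z.im ^ 2 - m * jacobiSn m z.re ^ 2 * jacobiSn (1 - m) z.im ^ 2) /
        snDen m z.re z.im ^ 2)
    (b := -jacobiSn m z.re * jacobiSn (1 - m) z.im * jacobiCn (1 - m) z.im *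
      ((jacobiDn m z.re ^ 2 + m * jacobiCn m z.re ^ 2) * snDen m z.re z.im +
        2 * m * jacobiCn m z.re ^ 2 * jacobiDn m z.re ^ 2 * jacobiSn (1 - m) z.im ^ 2) /
        snDen m z.re z.im ^ 2)
    (((s.mul_const _).div Dx hz).congr_deriv ?_)
    ((((c.mul d).mul_const _).div Dx hz).congr_deriv ?_)
    (((d'.const_mul _).div Dy hz).congr_deriv ?_)
    ((((s'.mul c').const_mul _).div Dy hz).congr_deriv ?_)
  · congr 1
    rw [hD]
    push_cast
    ring
  · congr 1
    rw [hD]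
    push_cast
    simp only [Pi.mul_apply]
    ring
  · rw [← neg_div]
    congr 1
    rw [hD]
    push_cast
    generalize jacobiSn m z.re = s at *
    generalize jacobiCn m z.re = c at *
    generalize jacobiDn m z.re = d at *
    generalize jacobiSn (1 - m) z.im = s' at *
    generalize jacobiCn (1 - m) z.im = c' at *
    generalize jacobiDn (1 - m) z.im = d' at *
    rw [ec, ed]
    clear * - ec' ed'
    grind
  · congr 1
    rw [hD]
    push_cast
    simp only [Pi.mul_apply]
    generalize jacobiSn (1 - m) z.im = s' at *
    generalize jacobiCn (1 - m) z.im = c' at *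
    clear * - ec'
    grind

/-- Both summands are nonnegative, so they vanish together, and `cn = 0` forces `sn² = 1` in the
second. -/
lemma snDen_eq_zero_iff {m : ℝ} (hm₀ : 0 < m) {x y : ℝ} :
    snDen m x y = 0 ↔ jacobiSn m x = 0 ∧ jacobiCn (1 - m) y = 0 := by
  have h := jacobiCn_sq (1 - m) y
  rw [snDen, add_eq_zero_iff_of_nonneg (by positivity) (by positivity)]
  constructor
  · rintro ⟨h1, h2⟩
    have h3 : jacobiSn (1 - m) y ^ 2 = 1 := by linarith
    rw [h3] at h2
    have h4 := hm₀.ne'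
    simp_all
  · rintro ⟨h1, h2⟩
    simp [h1, h2]

/-- The numerator of `‖sn (x + i y)‖²`, as a fraction with denominator `snDen m x y`. -/
def snNum (m x y : ℝ) : ℝ :=
  jacobiSn (1 - m) y ^ 2 + jacobiSn m x ^ 2 * jacobiCn (1 - m) y ^ 2

/-- This locates the zeros and controls the poles through two nonnegative continuous functions. At a
pole both sides are `0`, by division by zero. -/
lemma norm_complexSn_sq {m : ℝ} (hm₀ : 0 < m) (hm : m < 1) (z : ℂ) :
    ‖complexSn m z‖ ^ 2 = snNum m z.re z.im / snDen m z.re z.im := by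
  have hn : ‖complexSn m z‖ ^ 2 = snRe m z.re z.im ^ 2 + snIm m z.re z.im ^ 2 := by
    rw [← Complex.normSq_eq_norm_sq, complexSn, Complex.normSq_add_mul_I]
  rw [hn]
  rcases eq_or_ne (snDen m z.re z.im) 0 with h0 | h0
  · simp [snRe, snIm, h0]
  rw [snRe, snIm, div_pow, div_pow, ← add_div, div_eq_div_iff (pow_ne_zero 2 h0) h0]
  simp only [mul_pow]
  have ec := jacobiCn_sq m z.re
  have ed := jacobiDn_sq hm z.re
  have ec' := jacobiCn_sq (1 - m) z.im
  have ed' := jacobiDn_sq (m := 1 - m) (by linarith) z.im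
  rw [snNum, snDen, ec, ed, ec', ed']
  ring

lemma continuous_snNum {m : ℝ} (hm₀ : 0 < m) (hm : m < 1) :
    Continuous (fun w : ℂ ↦ snNum m w.re w.im) := by
  have h1 : Continuous (jacobiSn m) := continuous_iff_continuousAt.mpr fun x ↦
    (hasDerivAt_jacobiSn hm₀.le hm x).continuousAt
  have h2 : Continuous (jacobiSn (1 - m)) := continuous_iff_continuousAt.mpr fun x ↦
    (hasDerivAt_jacobiSn (m := 1 - m) (by linarith) (by linarith) x).continuousAt
  have h3 : Continuous (jacobiCn (1 - m)) := continuous_iff_continuousAt.mpr fun x ↦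
    (hasDerivAt_jacobiCn (m := 1 - m) (by linarith) (by linarith) x).continuousAt
  have h4 := Complex.continuous_re
  have h5 := Complex.continuous_im
  exact ((h2.comp h5).pow 2).add (((h1.comp h4).pow 2).mul ((h3.comp h5).pow 2))

/-- At a zero, `sn` in `x` and `cn` in `y` have nonzero derivatives, so each coordinate is isolated.
-/
lemma eventually_snDen_ne_zero {m : ℝ} (hm₀ : 0 < m) (hm : m < 1) (z : ℂ) :
    ∀ᶠ w in 𝓝[≠] z, snDen m w.re w.im ≠ 0 := by
  by_cases hz : snDen m z.re z.im = 0
  swap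
  · exact ((continuous_snDen hm₀ hm).continuousAt.eventually_ne hz).filter_mono nhdsWithin_le_nhds
  obtain ⟨hs, hc⟩ := (snDen_eq_zero_iff hm₀).mp hz
  have es := jacobiCn_sq m z.re
  have ec := jacobiCn_sq (1 - m) z.im
  have n1 : jacobiCn m z.re * jacobiDn m z.re ≠ 0 := by
    refine mul_ne_zero (fun h ↦ ?_) (jacobiDn_pos hm _).ne'
    simp [h, hs] at es
  have n2 : -jacobiSn (1 - m) z.im * jacobiDn (1 - m) z.im ≠ 0 := by
    refine mul_ne_zero (fun h ↦ ?_) (jacobiDn_pos (by linarith) _).ne'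
    rw [neg_eq_zero] at h
    simp [h, hc] at ec
  have e1 := (hasDerivAt_jacobiSn hm₀.le hm z.re).eventually_ne (c := 0) n1
  have e2 := (hasDerivAt_jacobiCn (m := 1 - m) (by linarith) (by linarith) z.im).eventually_ne
    (c := 0) n2
  rw [eventually_nhdsWithin_iff] at e1 e2 ⊢
  filter_upwards [Complex.continuous_re.continuousAt.eventually e1,
    Complex.continuous_im.continuousAt.eventually e2] with w h1 h2 hw h0
  obtain ⟨g1, g2⟩ := (snDen_eq_zero_iff hm₀).mp h0
  refine hw (Complex.ext ?_ ?_)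
  · by_contra h
    exact h1 h g1
  · by_contra h
    exact h2 h g2

lemma analyticAt_complexSn {m : ℝ} (hm₀ : 0 < m) (hm : m < 1) {z : ℂ}
    (hz : snDen m z.re z.im ≠ 0) : AnalyticAt ℂ (complexSn m) z :=
  Complex.analyticAt_iff_eventually_differentiableAt.mpr
    (((continuous_snDen hm₀ hm).continuousAt.eventually_ne hz).mono
      fun _ hw ↦ differentiableAt_complexSn hm₀ hm hw)

lemma complexSn_eq_zero_of_snDen_eq_zero {m : ℝ} {z : ℂ} (hz : snDen m z.re z.im = 0) :
    complexSn m z = 0 := by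
  simp [complexSn, snRe, snIm, hz]

lemma eventually_complexSn_ne_zero {m : ℝ} (hm₀ : 0 < m) (hm : m < 1) {z : ℂ}
    (hz : snDen m z.re z.im = 0) : ∀ᶠ w in 𝓝[≠] z, complexSn m w ≠ 0 := by
  obtain ⟨-, hc⟩ := (snDen_eq_zero_iff hm₀).mp hz
  have ec := jacobiCn_sq (1 - m) z.im
  have hN : snNum m z.re z.im ≠ 0 := by
    have : jacobiSn (1 - m) z.im ^ 2 = 1 := by rw [hc] at ec; linarith
    simp [snNum, hc, this]
  filter_upwards [eventually_snDen_ne_zero hm₀ hm z,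
    ((continuous_snNum hm₀ hm).continuousAt.eventually_ne hN).filter_mono nhdsWithin_le_nhds]
    with w h1 h2 h3
  have := norm_complexSn_sq hm₀ hm w
  rw [h3, norm_zero, zero_pow two_ne_zero] at this
  exact div_ne_zero h2 h1 this.symm

/-- The removable singularity theorem applies: `|1/sn|` tends to `0`, which is also the assigned
value `0⁻¹`. -/
lemma analyticAt_complexSn_inv {m : ℝ} (hm₀ : 0 < m) (hm : m < 1) {z : ℂ}
    (hz : snDen m z.re z.im = 0) : AnalyticAt ℂ (fun w ↦ (complexSn m w)⁻¹) z := by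
  obtain ⟨-, hc⟩ := (snDen_eq_zero_iff hm₀).mp hz
  have ec := jacobiCn_sq (1 - m) z.im
  have hN : snNum m z.re z.im ≠ 0 := by
    have : jacobiSn (1 - m) z.im ^ 2 = 1 := by rw [hc] at ec; linarith
    simp [snNum, hc, this]
  apply Complex.analyticAt_of_differentiable_on_punctured_nhds_of_continuousAt
  · filter_upwards [eventually_snDen_ne_zero hm₀ hm z, eventually_complexSn_ne_zero hm₀ hm hz]
      with w h1 h2
    exact (differentiableAt_complexSn hm₀ hm h1).inv h2
  · rw [ContinuousAt, complexSn_eq_zero_of_snDen_eq_zero hz, inv_zero,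
      tendsto_zero_iff_norm_tendsto_zero]
    have hn : (fun w ↦ ‖(complexSn m w)⁻¹‖) =
        fun w : ℂ ↦ √(snDen m w.re w.im / snNum m w.re w.im) := by
      funext w
      rw [norm_inv, ← inv_div, ← norm_complexSn_sq hm₀ hm, Real.sqrt_inv,
        Real.sqrt_sq (norm_nonneg _)]
    rw [hn]
    have := ((continuous_snDen hm₀ hm).continuousAt (x := z)).div
      (continuous_snNum hm₀ hm).continuousAt hN
    simpa [hz] using this.tendsto.sqrt

/-! ### An elliptic function of order two -/

/-- The elliptic function `1 - 2 c sn²`, with the value `0` at its poles. -/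
def snForm (m c : ℝ) (z : ℂ) : ℂ :=
  if snDen m z.re z.im = 0 then 0 else 1 - 2 * c * complexSn m z ^ 2

/-- Near a pole, with `v = 1/sn`, the function is the inverse of `v² / (v² - 2c)`, analytic there
because `c ≠ 0`; inversion preserves normal form. -/
lemma meromorphicNFAt_snForm {m c : ℝ} (hm₀ : 0 < m) (hm : m < 1) (hc : c ≠ 0) (z : ℂ) :
    MeromorphicNFAt (snForm m c) z := by
  by_cases hz : snDen m z.re z.im = 0
  · have h := analyticAt_complexSn_inv hm₀ hm hz
    have ha : AnalyticAt ℂ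
        (fun w ↦ (complexSn m w)⁻¹ ^ 2 / ((complexSn m w)⁻¹ ^ 2 - 2 * c)) z := by
      refine (h.pow 2).div ((h.pow 2).sub analyticAt_const) ?_
      simpa [complexSn_eq_zero_of_snDen_eq_zero hz] using hc
    rw [meromorphicNFAt_congr (g :=
      (fun w ↦ (complexSn m w)⁻¹ ^ 2 / ((complexSn m w)⁻¹ ^ 2 - 2 * c))⁻¹)]
    · exact ha.meromorphicNFAt.inv
    have h1 := eventually_snDen_ne_zero hm₀ hm z
    have h2 := eventually_complexSn_ne_zero hm₀ hm hz
    rw [eventually_nhdsWithin_iff] at h1 h2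
    filter_upwards [h1, h2] with w g1 g2
    by_cases hw : w = z
    · simp [hw, snForm, hz, complexSn_eq_zero_of_snDen_eq_zero hz]
    · have := g2 hw
      simp only [snForm, g1 hw, if_false, Pi.inv_apply, inv_div]
      field_simp
  · refine AnalyticAt.meromorphicNFAt ?_
    have h : AnalyticAt ℂ (fun w ↦ 1 - 2 * c * complexSn m w ^ 2) z :=
      analyticAt_const.sub (analyticAt_const.mul ((analyticAt_complexSn hm₀ hm hz).pow 2))
    refine h.congr ?_
    filter_upwards [(continuous_snDen hm₀ hm).continuousAt.eventually_ne hz] with w hw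
    simp [snForm, hw]

/-! ### Periods of `1 - 2 c sn²` and the points where it equals `1` -/

lemma snForm_add_two_mul_ellipticK {m c : ℝ} (hm₀ : 0 < m) (hm : m < 1) (z : ℂ) :
    snForm m c (z + 2 * ellipticK m) = snForm m c z := by
  have e1 : (z + 2 * (ellipticK m : ℂ)).re = z.re + 2 * ellipticK m := by simp
  have e2 : (z + 2 * (ellipticK m : ℂ)).im = z.im := by simp
  have eD : snDen m (z.re + 2 * ellipticK m) z.im = snDen m z.re z.im := by
    simp [snDen, jacobiSn_add_two_mul_ellipticK hm₀.le hm]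
  have eS : complexSn m (z + 2 * ellipticK m) = -complexSn m z := by
    rw [complexSn, complexSn, e1, e2]
    simp only [snRe, snIm, eD, jacobiSn_add_two_mul_ellipticK hm₀.le hm,
      jacobiCn_add_two_mul_ellipticK hm₀.le hm, jacobiDn_add_two_mul_ellipticK hm₀.le hm]
    push_cast
    ring
  rw [snForm, snForm, eS, e1, e2, eD, neg_sq]

lemma snForm_add_two_mul_I_mul_ellipticK {m c : ℝ} (hm₀ : 0 < m) (hm : m < 1) (z : ℂ) :
    snForm m c (z + 2 * Complex.I * ellipticK (1 - m)) = snForm m c z := by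
  have hm' : 0 ≤ 1 - m := by linarith
  have hm'' : 1 - m < 1 := by linarith
  have e1 : (z + 2 * Complex.I * (ellipticK (1 - m) : ℂ)).re = z.re := by simp
  have e2 : (z + 2 * Complex.I * (ellipticK (1 - m) : ℂ)).im =
    z.im + 2 * ellipticK (1 - m) := by simp
  have eD : snDen m z.re (z.im + 2 * ellipticK (1 - m)) = snDen m z.re z.im := by
    simp [snDen, jacobiSn_add_two_mul_ellipticK hm' hm'', jacobiCn_add_two_mul_ellipticK hm' hm'']
  have eS : complexSn m (z + 2 * Complex.I * ellipticK (1 - m)) = complexSn m z := by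
    rw [complexSn, complexSn, e1, e2]
    simp only [snRe, snIm, eD, jacobiSn_add_two_mul_ellipticK hm' hm'',
      jacobiCn_add_two_mul_ellipticK hm' hm'', jacobiDn_add_two_mul_ellipticK hm' hm'']
    push_cast
    ring
  rw [snForm, snForm, eS, e1, e2, eD]

lemma complexSn_ofReal {m : ℝ} (hm₀ : 0 < m) (t : ℝ) : complexSn m t = jacobiSn m t := by
  have h : 1 - m < 1 := by linarith
  simp [complexSn, snRe, snIm, snDen, jacobiSn_zero h, jacobiCn_zero h, jacobiDn_zero h]

lemma snForm_ofReal {m c : ℝ} (hm₀ : 0 < m) (t : ℝ) :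
    snForm m c t = 1 - 2 * c * (jacobiSn m t : ℂ) ^ 2 := by
  have h : 1 - m < 1 := by linarith
  rw [snForm, complexSn_ofReal hm₀]
  simp [snDen, jacobiSn_zero h, jacobiCn_zero h]

lemma analyticAt_snForm_zero {m c : ℝ} (hm₀ : 0 < m) (hm : m < 1) :
    AnalyticAt ℂ (snForm m c) 0 := by
  have h1 : 1 - m < 1 := by linarith
  have hz : snDen m (0 : ℂ).re (0 : ℂ).im ≠ 0 := by
    simp [snDen, jacobiSn_zero h1, jacobiCn_zero h1]
  have h : AnalyticAt ℂ (fun w ↦ 1 - 2 * c * complexSn m w ^ 2) 0 :=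
    analyticAt_const.sub (analyticAt_const.mul ((analyticAt_complexSn hm₀ hm hz).pow 2))
  refine h.congr ?_
  filter_upwards [(continuous_snDen hm₀ hm).continuousAt.eventually_ne hz] with w hw
  simp [snForm, hw]

lemma eq_lattice_of_snForm_eq_one {m c : ℝ} (hm₀ : 0 < m) (hm : m < 1) (hc : c ≠ 0) {z : ℂ}
    (hz : snForm m c z = 1) :
    ∃ n k : ℤ, z = n * (2 * ellipticK m) + k * (2 * Complex.I * ellipticK (1 - m)) := by
  -- The value assigned at a pole is `0`, so poles are excluded.
  have hD : snDen m z.re z.im ≠ 0 := by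
    intro h
    simp [snForm, h] at hz
  have hS : complexSn m z = 0 := by simpa [snForm, hD, hc] using hz
  have hn := norm_complexSn_sq hm₀ hm z
  rw [hS, norm_zero, zero_pow two_ne_zero, eq_comm, div_eq_zero_iff, or_iff_left hD, snNum,
    add_eq_zero_iff_of_nonneg (by positivity) (by positivity)] at hn
  have h1 : jacobiSn (1 - m) z.im = 0 := by simpa using hn.1
  have h2 : jacobiSn m z.re = 0 := by
    have := hn.2
    rw [jacobiCn_sq, h1] at this
    simpa using this
  obtain ⟨n, hn⟩ := eq_int_mul_of_jacobiSn_eq_zero hm₀.le hm h2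
  obtain ⟨k, hk⟩ := eq_int_mul_of_jacobiSn_eq_zero (m := 1 - m) (by linarith) (by linarith) h1
  refine ⟨n, k, Complex.ext ?_ ?_⟩
  · simp [hn]
  · simp [hk]

end SignatureFour

end

noncomputable section

namespace SignatureFour

/-! ### Identification near the origin -/

/-- Uniqueness for the equation `σ'' = -σ + 2 σ³` on the real line. -/
lemma eventuallyEq_of_second_order_ode {f₁ f₂ g₁ g₂ : ℝ → ℂ}
    (hf : ∀ᶠ t in 𝓝 (0 : ℝ), HasDerivAt f₁ (f₂ t) t ∧
      HasDerivAt f₂ (-f₁ t + 2 * f₁ t ^ 3) t)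
    (hg : ∀ᶠ t in 𝓝 (0 : ℝ), HasDerivAt g₁ (g₂ t) t ∧
      HasDerivAt g₂ (-g₁ t + 2 * g₁ t ^ 3) t)
    (h₁ : f₁ 0 = g₁ 0) (h₂ : f₂ 0 = g₂ 0) : f₁ =ᶠ[𝓝 0] g₁ := by
  let v : ℂ × ℂ → ℂ × ℂ := fun p ↦ (p.2, -p.1 + 2 * p.1 ^ 3)
  have hv : ContDiff ℝ 1 v := by fun_prop
  obtain ⟨K, t, ht, hK⟩ := (hv.contDiffAt (x := (f₁ 0, f₂ 0))).exists_lipschitzOnWith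
  have cf : ContinuousAt (fun t ↦ (f₁ t, f₂ t)) 0 :=
    hf.self_of_nhds.1.continuousAt.prodMk hf.self_of_nhds.2.continuousAt
  have cg : ContinuousAt (fun t ↦ (g₁ t, g₂ t)) 0 :=
    hg.self_of_nhds.1.continuousAt.prodMk hg.self_of_nhds.2.continuousAt
  have h := ODE_solution_unique_of_eventually (v := fun _ ↦ v) (s := fun _ ↦ t) (K := K)
    (f := fun t ↦ (f₁ t, f₂ t)) (g := fun t ↦ (g₁ t, g₂ t)) (t₀ := 0)
    (Eventually.of_forall fun _ ↦ hK)
    (by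
      filter_upwards [hf, cf.eventually_mem ht] with s hs hm
      exact ⟨hs.1.prodMk hs.2, hm⟩)
    (by
      rw [h₁, h₂] at ht
      filter_upwards [hg, cg.eventually_mem ht] with s hs hm
      exact ⟨hs.1.prodMk hs.2, hm⟩)
    (by simp [h₁, h₂])
  exact h.mono fun s hs ↦ congrArg Prod.fst hs

/-- In general `(b sn(a t))'' = -a²(1 + m) b sn + 2a² m b sn³`; the two relations normalize these
coefficients. -/
lemma hasDerivAt_scaled_jacobiSn {m a b : ℝ} (hm₀ : 0 ≤ m) (hm : m < 1)
    (h₁ : a ^ 2 * (1 + m) = 1) (h₂ : a ^ 2 * m = b ^ 2) (t : ℝ) :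
    HasDerivAt (fun t ↦ b * jacobiSn m (a * t))
      (b * a * (jacobiCn m (a * t) * jacobiDn m (a * t))) t ∧
    HasDerivAt (fun t ↦ b * a * (jacobiCn m (a * t) * jacobiDn m (a * t)))
      (-(b * jacobiSn m (a * t)) + 2 * (b * jacobiSn m (a * t)) ^ 3) t := by
  have hl : HasDerivAt (fun t ↦ a * t) a t := by simpa using (hasDerivAt_id t).const_mul a
  have s := (hasDerivAt_jacobiSn hm₀ hm (a * t)).comp t hl
  have c := (hasDerivAt_jacobiCn hm₀ hm (a * t)).comp t hl
  have d := (hasDerivAt_jacobiDn hm₀ hm (a * t)).comp t hl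
  refine ⟨(s.const_mul b).congr_deriv (by ring), ((c.mul d).const_mul (b * a)).congr_deriv ?_⟩
  have ec := jacobiCn_sq m (a * t)
  have ed := jacobiDn_sq hm (a * t)
  simp only [Function.comp_apply]
  linear_combination (-b * a ^ 2 * jacobiSn m (a * t)) * ed
    - b * a ^ 2 * m * jacobiSn m (a * t) * ec - b * jacobiSn m (a * t) * h₁
    + 2 * b * jacobiSn m (a * t) ^ 3 * h₂

/-- The function `dn₂` of modulus `κ = √(1 - lam²)`, expressed through the Jacobi function `sn`. -/
def dnTwo (lam : ℝ) (u : ℂ) : ℂ :=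
  snForm ((1 - lam) / (1 + lam)) ((1 - lam) / 2) ((√((1 + lam) / 2) : ℝ) * u)

lemma modulus_mem {lam : ℝ} (h₀ : 0 < lam) (h₁ : lam < 1) :
    0 < (1 - lam) / (1 + lam) ∧ (1 - lam) / (1 + lam) < 1 := by
  refine ⟨div_pos (by linarith) (by linarith), ?_⟩
  rw [div_lt_one (by linarith)]
  linarith

lemma one_sub_modulus {lam : ℝ} (h₀ : 0 < lam) :
    1 - (1 - lam) / (1 + lam) = 2 * lam / (1 + lam) := by
  have : 1 + lam ≠ 0 := by linarith
  field_simp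
  ring

lemma meromorphicNFOn_dnTwo {lam : ℝ} (h₀ : 0 < lam) (h₁ : lam < 1) :
    MeromorphicNFOn (dnTwo lam) Set.univ := by
  intro u _
  obtain ⟨hm₀, hm⟩ := modulus_mem h₀ h₁
  have ha : √((1 + lam) / 2) ≠ 0 := (Real.sqrt_pos.mpr (by linarith)).ne'
  have hl : AnalyticAt ℂ (fun u : ℂ ↦ ((√((1 + lam) / 2) : ℝ) : ℂ) * u) u := by fun_prop
  have h := meromorphicNFAt_snForm (c := (1 - lam) / 2) hm₀ hm (by linarith)
    (((√((1 + lam) / 2) : ℝ) : ℂ) * u)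
  exact h.comp_analyticAt (g := fun u : ℂ ↦ ((√((1 + lam) / 2) : ℝ) : ℂ) * u) hl

lemma cos_eq_dnTwo {κ lam : ℝ} (hκ : 0 < κ) (h₀ : 0 < lam) (h₁ : lam < 1)
    (h : lam ^ 2 = 1 - κ ^ 2) {φ ψ : ℂ → ℂ} (hφ : IsLocalAmplitude κ φ)
    (hψ : IsAuxiliaryAngle κ φ ψ) : ∀ᶠ u in 𝓝 (0 : ℂ), dnTwo lam u = Complex.cos (ψ u) := by
  obtain ⟨hm₀, hm⟩ := modulus_mem h₀ h₁
  set m := (1 - lam) / (1 + lam) with hmdef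
  set a := √((1 + lam) / 2) with hadef
  set b := √((1 - lam) / 2) with hbdef
  have hl : 1 + lam ≠ 0 := by linarith
  have ha : a ^ 2 = (1 + lam) / 2 := Real.sq_sqrt (by linarith)
  have hb : b ^ 2 = (1 - lam) / 2 := Real.sq_sqrt (by linarith)
  -- This matches the initial slopes; `κ > 0` fixes the sign of the root.
  have hba : b * a = κ / 2 := by
    rw [← Real.sqrt_mul (by linarith),
      show (1 - lam) / 2 * ((1 + lam) / 2) = (κ / 2) ^ 2 by linear_combination -h / 4,
      Real.sqrt_sq (by positivity)]
  have hreal : ∀ᶠ t : ℝ in 𝓝 0, Complex.sin (ψ t / 2) = ((b * jacobiSn m (a * t) : ℝ) : ℂ) := by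
    refine eventuallyEq_of_second_order_ode
      (f₁ := fun t : ℝ ↦ Complex.sin (ψ t / 2)) (f₂ := fun t : ℝ ↦ κ / 2 * Complex.cos (φ t))
      (g₁ := fun t : ℝ ↦ ((b * jacobiSn m (a * t) : ℝ) : ℂ))
      (g₂ := fun t : ℝ ↦ ((b * a * (jacobiCn m (a * t) * jacobiDn m (a * t)) : ℝ) : ℂ))
      ?_ (Eventually.of_forall fun t ↦ ?_) ?_ ?_
    · have ht : Tendsto (fun t : ℝ ↦ (t : ℂ)) (𝓝 0) (𝓝 0) := by
        simpa using Complex.continuous_ofReal.tendsto 0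
      filter_upwards [ht.eventually (hasDerivAt_sin_half_angle hφ hψ)] with t ht
      exact ⟨ht.1.comp_ofReal, ht.2.comp_ofReal⟩
    · obtain ⟨e1, e2⟩ := hasDerivAt_scaled_jacobiSn (a := a) (b := b) hm₀.le hm
        (by rw [ha, hmdef]; field_simp; ring) (by rw [ha, hb, hmdef]; field_simp) t
      refine ⟨e1.ofReal_comp, ?_⟩
      have := e2.ofReal_comp
      push_cast at this ⊢
      exact this
    · simp [hψ.map_zero, jacobiSn_zero hm]
    · simp [hφ.map_zero, jacobiCn_zero hm, jacobiDn_zero hm, hba]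
  have hana : AnalyticAt ℂ (dnTwo lam) 0 := by
    have hl : AnalyticAt ℂ (fun u : ℂ ↦ (a : ℂ) * u) 0 := by fun_prop
    exact AnalyticAt.fun_comp (g := snForm m ((1 - lam) / 2)) (f := fun u : ℂ ↦ (a : ℂ) * u)
      (by simpa using analyticAt_snForm_zero hm₀ hm) hl
  have hcos : AnalyticAt ℂ (fun u ↦ Complex.cos (ψ u)) 0 := by
    have := hψ.analyticAt
    fun_prop
  -- Identity theorem: agreement at real points accumulating at `0` suffices.
  refine (hana.frequently_eq_iff_eventually_eq hcos).mp ?_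
  have hto : Tendsto (fun t : ℝ ↦ (t : ℂ)) (𝓝[≠] 0) (𝓝[≠] 0) := by
    refine tendsto_nhdsWithin_of_tendsto_nhds_of_eventually_within _ ?_ ?_
    · simpa using (Complex.continuous_ofReal.tendsto 0).mono_left nhdsWithin_le_nhds
    · filter_upwards [self_mem_nhdsWithin] with t ht
      simpa using ht
  refine hto.frequently (Eventually.frequently ?_)
  filter_upwards [hreal.filter_mono nhdsWithin_le_nhds] with t ht
  have hc : Complex.cos (ψ t) = 1 - 2 * Complex.sin (ψ t / 2) ^ 2 := by
    rw [← Complex.cos_two_mul_eq_one_sub]; congr 1; ring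
  have hbC : ((b ^ 2 : ℝ) : ℂ) = (((1 - lam) / 2 : ℝ) : ℂ) := by rw [hb]
  rw [hc, ht, dnTwo, ← hmdef, ← hadef, ← Complex.ofReal_mul, snForm_ofReal hm₀, ← hbC]
  push_cast
  ring

/-- Infinite order of `f - g` propagates over the connected plane; normal form then forces equality
at every point, poles included. -/
lemma eq_of_meromorphicNFOn_of_eventuallyEq {f g : ℂ → ℂ} (hf : MeromorphicNFOn f Set.univ)
    (hg : MeromorphicNFOn g Set.univ) {x : ℂ} (h : f =ᶠ[𝓝 x] g) : f = g := by
  have hm : MeromorphicOn (f - g) Set.univ := hf.meromorphicOn.sub hg.meromorphicOn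
  have hx : meromorphicOrderAt (f - g) x = ⊤ := by
    rw [meromorphicOrderAt_eq_top_iff]
    filter_upwards [h.filter_mono nhdsWithin_le_nhds] with z hz
    simp [hz]
  funext z
  have hz : meromorphicOrderAt (f - g) z = ⊤ := by
    by_contra hne
    exact hm.meromorphicOrderAt_ne_top_of_isPreconnected isPreconnected_univ (Set.mem_univ z)
      (Set.mem_univ x) hne hx
  rw [meromorphicOrderAt_eq_top_iff] at hz
  have he : f =ᶠ[𝓝[≠] z] g := hz.mono fun w hw ↦ sub_eq_zero.mp hw
  exact (((hf (Set.mem_univ z)).eventuallyEq_nhdsNE_iff_eventuallyEq_nhds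
    (hg (Set.mem_univ z))).mp he).self_of_nhds

lemma isDn_iff {κ lam : ℝ} (hκ : 0 < κ) (h₀ : 0 < lam) (h₁ : lam < 1)
    (h : lam ^ 2 = 1 - κ ^ 2) (d : ℂ → ℂ) : IsDn κ d ↔ d = dnTwo lam := by
  have hm := meromorphicNFOn_dnTwo h₀ h₁
  constructor
  · rintro ⟨hd, φ, ψ, hφ, hψ, he⟩
    refine eq_of_meromorphicNFOn_of_eventuallyEq hd hm (x := 0) ?_
    filter_upwards [he, cos_eq_dnTwo hκ h₀ h₁ h hφ hψ] with u e1 e2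
    rw [e1, e2]
  · rintro rfl
    obtain ⟨φ, hφ⟩ := exists_isLocalAmplitude κ
    obtain ⟨ψ, hψ⟩ := exists_isAuxiliaryAngle hφ
    exact ⟨hm, φ, ψ, hφ, hψ, cos_eq_dnTwo hκ h₀ h₁ h hφ hψ⟩

/-! ### Fundamental periods -/

lemma linearIndependent_two_mul {K K' : ℝ} (hK : 0 < K) (hK' : 0 < K') :
    LinearIndependent ℝ ![2 * (K : ℂ), 2 * Complex.I * (K' : ℂ)] := by
  rw [LinearIndependent.pair_iff]
  intro s t hst
  have h1 := congrArg Complex.re hst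
  have h2 := congrArg Complex.im hst
  simp at h1 h2
  exact ⟨h1.resolve_right hK.ne', h2.resolve_right hK'.ne'⟩

lemma periodic_dnTwo_iff {lam : ℝ} (h₀ : 0 < lam) (h₁ : lam < 1) (w : ℂ) :
    Function.Periodic (dnTwo lam) w ↔ ∃ n k : ℤ, w =
      n * (2 * (√(2 / (1 + lam)) * ellipticK ((1 - lam) / (1 + lam)) : ℝ)) +
      k * (2 * Complex.I * (√(2 / (1 + lam)) * ellipticK (2 * lam / (1 + lam)) : ℝ)) := by
  obtain ⟨hm₀, hm⟩ := modulus_mem h₀ h₁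
  rw [← one_sub_modulus h₀]
  have hpos : 0 < √((1 + lam) / 2) := Real.sqrt_pos.mpr (by linarith)
  have hinv : √(2 / (1 + lam)) = (√((1 + lam) / 2))⁻¹ := by rw [← Real.sqrt_inv, inv_div]
  rw [hinv]
  have haC : ((√((1 + lam) / 2) : ℝ) : ℂ) ≠ 0 := by exact_mod_cast hpos.ne'
  constructor
  · intro hp
    have h0 : dnTwo lam 0 = 1 := by
      have := snForm_ofReal (c := (1 - lam) / 2) hm₀ 0
      rw [jacobiSn_zero hm] at this
      simpa [dnTwo] using this
    have hw : dnTwo lam w = 1 := by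
      have := hp 0
      rwa [zero_add, h0] at this
    -- A period sends `0` to another point of value `1`, hence into the rescaled lattice.
    obtain ⟨n, k, hnk⟩ := eq_lattice_of_snForm_eq_one hm₀ hm (by linarith) hw
    refine ⟨n, k, mul_left_cancel₀ haC ?_⟩
    rw [hnk]
    push_cast
    field_simp
  · rintro ⟨n, k, rfl⟩
    refine Function.Periodic.add_period (Function.Periodic.int_mul ?_ n)
      (Function.Periodic.int_mul ?_ k)
    · intro u
      rw [dnTwo, dnTwo, ← snForm_add_two_mul_ellipticK hm₀ hm (_ * u)]
      congr 1
      push_cast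
      field_simp
    · intro u
      rw [dnTwo, dnTwo, ← snForm_add_two_mul_I_mul_ellipticK hm₀ hm (_ * u)]
      congr 1
      push_cast
      field_simp

/-- Both multipliers are positive integers, so `x ≥ y` and `y ≥ x`. -/
lemma eq_of_int_mul_eq {x y : ℝ} (hx : 0 < x) (hy : 0 < y) {m n : ℤ} (h₁ : x = m * y)
    (h₂ : y = n * x) : x = y := by
  have hm : (0 : ℝ) < m := by
    by_contra! h
    nlinarith
  have hn : (0 : ℝ) < n := by
    by_contra! h
    nlinarith
  have hm' : (1 : ℝ) ≤ m := by exact_mod_cast (Int.cast_pos.mp hm : 0 < m)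
  have hn' : (1 : ℝ) ≤ n := by exact_mod_cast (Int.cast_pos.mp hn : 0 < n)
  nlinarith

/-- A rectangular period lattice determines its positive half-periods. -/
lemma isFundamentalPeriods_rectangular_iff {d : ℂ → ℂ} {K₀ K₀' K K' : ℝ} (hK₀ : 0 < K₀)
    (hK₀' : 0 < K₀') (hK : 0 < K) (hK' : 0 < K')
    (hd : ∀ w, Function.Periodic d w ↔ ∃ n k : ℤ,
      w = n * (2 * (K₀ : ℂ)) + k * (2 * Complex.I * (K₀' : ℂ))) :
    IsFundamentalPeriods d (2 * (K : ℂ)) (2 * Complex.I * (K' : ℂ)) ↔ K = K₀ ∧ K' = K₀' := by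
  constructor
  · rintro ⟨-, h⟩
    obtain ⟨n₁, k₁, e₁⟩ := (hd (2 * K)).mp ((h _).mpr ⟨1, 0, by simp⟩)
    obtain ⟨n₂, k₂, e₂⟩ := (hd (2 * Complex.I * K')).mp ((h _).mpr ⟨0, 1, by simp⟩)
    obtain ⟨n₃, k₃, e₃⟩ := (h (2 * K₀)).mp ((hd _).mpr ⟨1, 0, by simp⟩)
    obtain ⟨n₄, k₄, e₄⟩ := (h (2 * Complex.I * K₀')).mp ((hd _).mpr ⟨0, 1, by simp⟩)
    -- Real and imaginary parts decouple the rectangular lattice, leaving mutual integer multiples.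
    have r₁ := congrArg Complex.re e₁
    have r₂ := congrArg Complex.im e₂
    have r₃ := congrArg Complex.re e₃
    have r₄ := congrArg Complex.im e₄
    simp at r₁ r₂ r₃ r₄
    exact ⟨eq_of_int_mul_eq hK hK₀ (m := n₁) (n := n₃) (by linarith) (by linarith),
      eq_of_int_mul_eq hK' hK₀' (m := k₂) (n := k₄) (by linarith) (by linarith)⟩
  · rintro ⟨rfl, rfl⟩
    exact ⟨linearIndependent_two_mul hK hK', hd⟩

end SignatureFour

end

theorem mainTheorem6 (κ lam : ℝ) (hκ₀ : 0 < κ) (hκ₁ : κ < 1) (hlam : lam = √(1 - κ ^ 2)) :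
    (∃! d : ℂ → ℂ, SignatureFour.IsDn κ d) ∧
    ∀ d : ℂ → ℂ, SignatureFour.IsDn κ d →
      ∀ K K' : ℝ, 0 < K → 0 < K' →
        (SignatureFour.IsFundamentalPeriods d (2 * (K : ℂ)) (2 * Complex.I * (K' : ℂ)) ↔
          K = √(2 / (1 + lam)) * SignatureFour.ellipticK ((1 - lam) / (1 + lam)) ∧
          K' = √(2 / (1 + lam)) * SignatureFour.ellipticK (2 * lam / (1 + lam))) := by
  have hp : 0 < 1 - κ ^ 2 := by nlinarith
  have h₀ : 0 < lam := hlam ▸ Real.sqrt_pos.mpr hp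
  have hsq : lam ^ 2 = 1 - κ ^ 2 := by rw [hlam, Real.sq_sqrt hp.le]
  have h₁ : lam < 1 := by nlinarith [sq_pos_of_pos hκ₀]
  have hdn := SignatureFour.isDn_iff hκ₀ h₀ h₁ hsq
  obtain ⟨hm₀, hm⟩ := SignatureFour.modulus_mem h₀ h₁
  refine ⟨⟨SignatureFour.dnTwo lam, (hdn _).mpr rfl, fun d hd ↦ (hdn d).mp hd⟩, ?_⟩
  intro d hd K K' hK hK'
  rw [(hdn d).mp hd]
  have hs : 0 < √(2 / (1 + lam)) := Real.sqrt_pos.mpr (by positivity)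
  refine SignatureFour.isFundamentalPeriods_rectangular_iff
    (mul_pos hs (SignatureFour.ellipticK_pos hm)) (mul_pos hs (SignatureFour.ellipticK_pos ?_))
    hK hK' (SignatureFour.periodic_dnTwo_iff h₀ h₁)
  -- The complementary parameter is `1 - m`, below `1` because `m > 0`.
  rw [← SignatureFour.one_sub_modulus h₀]
  linarith
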